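/- Let $X$ be a complex Banach space, let $A$ be a bounded linear operator on $X$, let $P$ be a bounded linear projection on $X$ (that is, $P^2=P$), and put $Q := I-P$. For a bounded operator $B$ and $\lambda\in\mathbb C\setminus\sigma(B)$ write $\mathcal R(\lambda,B) := (\lambda-B)^{-1}$; all norms of operators are operator norms. (i) As $\operatorname{Re} z\to-\infty$, $e^{t(A+zP)}$ converges to $e^{tQAQ}Q$ at least at a linear rate in $1/|\operatorname{Re} z|$, uniformly for $t$ in compact subsets of $(0,\infty)$: for every compact $K\subset(0,\infty)$ there are constants $C$ and $s>0$ such that $$\|e^{t(A+zP)}-e^{tQAQ}Q\|\le \frac{C}{|\operatorname{Re} z|}\qquad\text{for all } t\in K \text{ and all } z\in\mathbb C \text{ with } \operatorname{Re} z<-s.$$ (ii) Let $0<T_1<T_2$, let $\delta>0$, and put $R := 2(\|A\|+\delta)\|P-Q\|$. Suppose that $\delta$ is so large that $R$ is strictly larger than the spectral radius of $QAQ$. Then the circle $|\lambda|=R$ lies in the resolvent set of $QAQ$, the supremum $S := \sup_{|\lambda|=R}\|I+AQ\,\mathcal R(\lambda,QAQ)\|$ is finite, and with $$C_1 := \frac{R\,e^{T_1R}}{\delta},\qquad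 C_2 := R\,e^{T_2R}\,\frac{\|A\|+\delta}{\delta}\,\|P\|\,S$$ one has, for every $z\in\mathbb C$ with $\operatorname{Re} z<-2R$ and every $t\in[T_1,T_2]$, $$\|e^{t(A+zP)}-e^{tQAQ}Q\|\le C_1\,e^{T_1\operatorname{Re} z}+\frac{C_2}{|z|-R}.$$ If moreover $R>\|QAQ\|$, then $$C_2\le R\,e^{T_2R}\,\frac{\|A\|+\delta}{\delta}\,\|P\|\left(1+\frac{\|AQ\|}{R-\|QAQ\|}\right).$$ -/

import Mathlib

open Filter Topology Metric

/-! ### Holomorphic functional calculus on a circle. -/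

section HolomorphicCalculus

variable {𝔸 : Type*} [NormedRing 𝔸] [NormedAlgebra ℂ 𝔸]

/-! Put `B = A + zP`, `J = P - Q`. The resolvent of `zP` is `r(w) = w⁻¹ Q + (w - z)⁻¹ P`. Since `2P
= 1 + J`, `2Q = 1 - J` and `‖J‖ ≥ 1` (as `J² = 1`), `R` is large enough to give `‖r(w)‖ ≤ 1 / (‖A‖ +
δ)` on the circles of radius `R` about `0` and `z`. So the resolvent of `B` exists there, as a
Neumann series in `r(w) A`, and is controlled by `r(w)` up to the factor `(‖A‖ + δ) / δ`.

The two circles together carry the whole functional calculus of `B`: `2πi exp(tB)` is the sum of the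
integrals of `exp(tw) (w - B)⁻¹`. The identity `w (w - B)⁻¹ = B (w - B)⁻¹ + 1` moves `exp(tw)` out
of each integral as `exp(tB)`, leaving only the case `t = 0`. That case is settled by integrating
the Neumann series: the residues of every term but the first add up to zero
(`circlePairIntegral_of_neumann`).

The circle about `z` lies far in the left half-plane and contributes the exponentially small term.
On the circle about `0`, subtracting the integral for `exp(tQAQ) Q` leaves `(w - B)⁻¹ P (1 + AQ (w -
QAQ)⁻¹)`. Because `r(w) P = (w - z)⁻¹ P`, its first factor `(w - B)⁻¹ P` is of order `1 / (|z| -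
R)`. -/

theorem smul_resolvent_eq {b : 𝔸} {w : ℂ} (hw : w ∈ resolventSet ℂ b) :
    w • resolvent b w = b * resolvent b w + 1 := by
  have h : (algebraMap ℂ 𝔸 w - b) * resolvent b w = 1 := Ring.mul_inverse_cancel _ hw
  rw [sub_mul, Algebra.algebraMap_eq_smul_one, smul_mul_assoc, one_mul, sub_eq_iff_eq_add] at h
  exact h.trans (add_comm _ _)

theorem sphere_subset_resolventSet_of_spectralRadius_lt {b : 𝔸} {R : ℝ}
    (h : spectralRadius ℂ b < ENNReal.ofReal R) : sphere (0 : ℂ) R ⊆ resolventSet ℂ b := by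
  intro w hw
  refine spectrum.mem_resolventSet_of_spectralRadius_lt (h.trans_eq ?_)
  rw [← mem_sphere_zero_iff_norm.1 hw, ofReal_norm, enorm_eq_nnnorm]

variable [CompleteSpace 𝔸]

theorem circleIntegral_const_mul (a : 𝔸) {f : ℂ → 𝔸} {c : ℂ} {R : ℝ}
    (hf : CircleIntegrable f c R) :
    (∮ w in C(c, R), a * f w) = a * ∮ w in C(c, R), f w := by
  have h := (ContinuousLinearMap.mul ℂ 𝔸 a).intervalIntegral_comp_comm hf.out
  simp only [circleIntegral]
  simpa [mul_smul_comm] using h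

theorem circleIntegral_mul_const (a : 𝔸) {f : ℂ → 𝔸} {c : ℂ} {R : ℝ}
    (hf : CircleIntegrable f c R) :
    (∮ w in C(c, R), f w * a) = (∮ w in C(c, R), f w) * a := by
  have h := ((ContinuousLinearMap.mul ℂ 𝔸).flip a).intervalIntegral_comp_comm hf.out
  simp only [circleIntegral]
  simpa [smul_mul_assoc] using h

/-- If `f` solves `(w - b) f w = a` on a circle, then multiplying the integrand by `w ^ n` amounts
to multiplying the integral by `b ^ n`. -/
theorem circleIntegral_pow_smul_of_smul_eq {a b : 𝔸} {f : ℂ → 𝔸} {c : ℂ} {R : ℝ} (hR : 0 ≤ R)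
    (hf : ContinuousOn f (sphere c R)) (h : ∀ w ∈ sphere c R, w • f w = b * f w + a) (n : ℕ) :
    (∮ w in C(c, R), w ^ n • f w) = b ^ n * ∮ w in C(c, R), f w := by
  induction n with
  | zero => simp
  | succ n ih =>
    have hpow : ContinuousOn (fun w : ℂ => w ^ n • f w) (sphere c R) :=
      (continuousOn_id.pow n).smul hf
    -- The inhomogeneous term has a polynomial integrand, so it drops out.
    have ha : (∮ w in C(c, R), w ^ n • a) = 0 := by
      have : (∮ w in C(c, R), w ^ n) = 0 := by
        simpa using circleIntegral.integral_sub_zpow_of_ne (n := (n : ℤ)) (by lia) c 0 R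
      rw [circleIntegral.integral_smul_const, this, zero_smul]
    calc (∮ w in C(c, R), w ^ (n + 1) • f w)
        = ∮ w in C(c, R), (b * (w ^ n • f w) + w ^ n • a) := by
          refine circleIntegral.integral_congr hR fun w hw => ?_
          simp only [pow_succ, mul_smul, h w hw, smul_add, mul_smul_comm]
      _ = b ^ (n + 1) * ∮ w in C(c, R), f w := by
          rw [circleIntegral.integral_add, ha, add_zero,
            circleIntegral_const_mul _ (hpow.circleIntegrable hR), ih, pow_succ', mul_assoc]
          · exact (continuousOn_const.mul hpow).circleIntegrable hR
          · exact ((continuousOn_id.pow n).smul continuousOn_const).circleIntegrable hR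

/-- If `f` solves `(w - b) f w = a` on a circle, then multiplying the integrand by `exp (t w)`
amounts to multiplying the integral by `exp (t b)`. -/
theorem circleIntegral_exp_smul_of_smul_eq {a b : 𝔸} {f : ℂ → 𝔸} {c : ℂ} {R : ℝ} (hR : 0 ≤ R)
    (hf : ContinuousOn f (sphere c R)) (h : ∀ w ∈ sphere c R, w • f w = b * f w + a) (t : ℂ) :
    (∮ w in C(c, R), Complex.exp (t * w) • f w)
      = NormedSpace.exp (t • b) * ∮ w in C(c, R), f w := by
  obtain ⟨M, hM⟩ := (isCompact_sphere c R).exists_bound_of_continuousOn hf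
  let F : ℕ → ℂ → 𝔸 := fun n w => ((n.factorial : ℂ)⁻¹ * t ^ n) • w ^ n • f w
  have hF : ∀ n, ContinuousOn (F n) (sphere c R) := fun n =>
    ((continuousOn_id.pow n).smul hf).const_smul _
  have hsum : Summable fun n : ℕ => (‖t‖ * (‖c‖ + R)) ^ n / n.factorial * M :=
    (Real.summable_pow_div_factorial _).mul_right M
  have hbound : ∀ n, ∀ w ∈ sphere c R, ‖F n w‖ ≤ (‖t‖ * (‖c‖ + R)) ^ n / n.factorial * M := by
    intro n w hw
    have hw' : ‖w‖ ≤ ‖c‖ + R := by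
      rw [mem_sphere_iff_norm] at hw
      linarith [norm_sub_norm_le w c]
    have hn : ‖F n w‖ = ((n.factorial : ℝ)⁻¹ * ‖t‖ ^ n * ‖w‖ ^ n) * ‖f w‖ := by
      simp [F, norm_smul, mul_assoc]
    rw [hn, mul_pow, div_eq_inv_mul, ← mul_assoc]
    have := hM w hw
    gcongr
  have hlim := (tendstoUniformlyOn_tsum_nat hsum hbound).tendsto_circleIntegral_of_continuousOn hR
    (Eventually.of_forall fun N => continuousOn_finsetSum _ fun n _ => hF n)
  have hexp : ∀ x : ℂ, HasSum (fun n : ℕ => (n.factorial : ℂ)⁻¹ * x ^ n) (Complex.exp x) := by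
    intro x
    rw [Complex.exp_eq_exp_ℂ]
    exact NormedSpace.exp_series_hasSum_exp' (𝕂 := ℂ) x
  have hl : (∮ w in C(c, R), ∑' n, F n w) = ∮ w in C(c, R), Complex.exp (t * w) • f w := by
    refine circleIntegral.integral_congr hR fun w _ => ?_
    refine (HasSum.tsum_eq ?_)
    refine ((hexp (t * w)).smul_const (f w)).congr_fun ?_
    intro n
    simp only [F, mul_pow, smul_smul, mul_assoc]
  rw [hl] at hlim
  refine tendsto_nhds_unique hlim ?_
  have hs : HasSum (fun n : ℕ => (n.factorial : ℂ)⁻¹ • (t • b) ^ n * ∮ w in C(c, R), f w)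
      (NormedSpace.exp (t • b) * ∮ w in C(c, R), f w) :=
    (NormedSpace.exp_series_hasSum_exp' (𝕂 := ℂ) (t • b)).mul_right _
  refine hs.tendsto_sum_nat.congr fun N => ?_
  rw [circleIntegral.integral_fun_sum fun n _ => (hF n).circleIntegrable hR]
  refine Finset.sum_congr rfl fun n _ => ?_
  simp only [F]
  rw [circleIntegral.integral_smul, circleIntegral_pow_smul_of_smul_eq hR hf h, smul_pow, smul_smul,
    smul_mul_assoc]

/-- Powers of an element decay relative to powers of any number above its spectral radius. -/
theorem tendsto_inv_pow_mul_norm_pow_of_spectralRadius_lt {a : 𝔸} {R : ℝ}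
    (h : spectralRadius ℂ a < ENNReal.ofReal R) :
    Tendsto (fun n : ℕ => R⁻¹ ^ n * ‖a ^ n‖) atTop (𝓝 0) := by
  have hR : 0 < R := ENNReal.ofReal_pos.1 (bot_le.trans_lt h)
  obtain ⟨r, hr, hrR⟩ := ENNReal.lt_iff_exists_nnreal_btwn.1 h
  have hrR' : (r : ℝ) < R := by
    rw [← ENNReal.ofReal_coe_nnreal] at hrR
    exact (ENNReal.ofReal_lt_ofReal_iff hR).1 hrR
  -- Gelfand's formula: the roots `‖a ^ n‖ ^ (1 / n)` are eventually below `r`, which was chosen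
  -- strictly below `R`.
  have hev : ∀ᶠ n : ℕ in atTop, R⁻¹ ^ n * ‖a ^ n‖ ≤ (r / R) ^ n := by
    filter_upwards [(spectrum.pow_norm_pow_one_div_tendsto_nhds_spectralRadius a).eventually_lt_const
      hr, eventually_ge_atTop 1] with n hn hn1
    rw [← ENNReal.ofReal_coe_nnreal] at hn
    have h1 := (ENNReal.ofReal_lt_ofReal_iff_of_nonneg (by positivity)).1 hn
    have h2 : ‖a ^ n‖ ≤ (r : ℝ) ^ n := by
      have h3 := pow_le_pow_left₀ (by positivity) h1.le n
      rwa [one_div, Real.rpow_inv_natCast_pow (norm_nonneg _) (by lia)] at h3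
    rw [div_pow, div_eq_inv_mul, inv_pow]
    gcongr
  refine squeeze_zero' (Eventually.of_forall fun n => by positivity) hev ?_
  exact tendsto_pow_atTop_nhds_zero_of_lt_one (by positivity) ((div_lt_one hR).2 hrR')

theorem continuousOn_resolvent {b : 𝔸} {s : Set ℂ} (hs : s ⊆ resolventSet ℂ b) :
    ContinuousOn (resolvent b) s := fun _ hw =>
  (spectrum.hasDerivAt_resolvent_const_left (hs hw)).continuousAt.continuousWithinAt

/-- The Riesz projection of a circle enclosing the whole spectrum is the identity. -/
theorem circleIntegral_resolvent_of_spectralRadius_lt {b : 𝔸} {R : ℝ}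
    (h : spectralRadius ℂ b < ENNReal.ofReal R) :
    (∮ w in C(0, R), resolvent b w) = (2 * Real.pi * Complex.I : ℂ) • (1 : 𝔸) := by
  have hR : 0 < R := ENNReal.ofReal_pos.1 (bot_le.trans_lt h)
  have hs := sphere_subset_resolventSet_of_spectralRadius_lt h
  have hc := continuousOn_resolvent hs
  have h0 : ∀ w ∈ sphere (0 : ℂ) R, w ≠ 0 := fun w hw => ne_of_mem_sphere hw hR.ne'
  have hinv : ContinuousOn (fun w : ℂ => w⁻¹) (sphere 0 R) := continuousOn_id.inv₀ h0
  obtain ⟨M, hM⟩ := (isCompact_sphere (0 : ℂ) R).exists_bound_of_continuousOn hc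
  have hrem : ∀ n : ℕ, CircleIntegrable (fun w => b ^ n * (w⁻¹ ^ n • resolvent b w)) 0 R :=
    fun n => (continuousOn_const.mul ((hinv.pow n).smul hc)).circleIntegrable hR.le
  -- Finite expansion of the resolvent in powers of `b / w`, with remainder. Only the term `w⁻¹` has
  -- a residue, so the remainder integral does not depend on `n`; it tends to zero because `R⁻¹ ^ n
  -- * ‖b ^ n‖` does.
  have hstep : ∀ n : ℕ, (∮ w in C(0, R), resolvent b w)
      = (∮ w in C(0, R), b ^ (n + 1) * (w⁻¹ ^ (n + 1) • resolvent b w))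
        + (2 * Real.pi * Complex.I : ℂ) • (1 : 𝔸) := by
    intro n
    have hpt : ∀ k : ℕ, ∀ w ∈ sphere (0 : ℂ) R, b ^ k * (w⁻¹ ^ k • resolvent b w)
        = b ^ (k + 1) * (w⁻¹ ^ (k + 1) • resolvent b w) + w ^ (-(k + 1 : ℤ)) • b ^ k := by
      intro k w hw
      have e : resolvent b w = w⁻¹ • (b * resolvent b w + 1) := by
        rw [← smul_resolvent_eq (hs hw), inv_smul_smul₀ (h0 w hw)]
      have hz : w ^ (-(k + 1 : ℤ)) = w⁻¹ ^ (k + 1) := by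
        rw [zpow_neg, inv_pow]; norm_cast
      rw [hz]
      conv_lhs => rw [e]
      simp only [smul_add, mul_add, mul_smul_comm, smul_smul, pow_succ, mul_assoc, mul_one]
    have hk : ∀ k : ℕ, CircleIntegrable (fun w : ℂ => w ^ (-(k + 1 : ℤ)) • b ^ k) 0 R := fun k =>
      ((continuousOn_id.zpow₀ _ fun w hw => Or.inl (h0 w hw)).smul
        continuousOn_const).circleIntegrable hR.le
    have hint : ∀ k : ℕ, (∮ w in C(0, R), b ^ k * (w⁻¹ ^ k • resolvent b w))
        = (∮ w in C(0, R), b ^ (k + 1) * (w⁻¹ ^ (k + 1) • resolvent b w))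
          + (∮ w in C(0, R), w ^ (-(k + 1 : ℤ))) • b ^ k := by
      intro k
      rw [circleIntegral.integral_congr hR.le (hpt k), circleIntegral.integral_add (hrem _) (hk k),
        circleIntegral.integral_smul_const]
    induction n with
    | zero =>
      have := hint 0
      have h1 : (∮ w in C(0, R), w ^ (-((0 : ℕ) + 1 : ℤ))) = 2 * Real.pi * Complex.I := by
        simpa using circleIntegral.integral_sub_center_inv 0 hR.ne'
      rw [h1] at this
      simpa using this
    | succ n ih =>
      have h1 : (∮ w in C(0, R), w ^ (-((n + 1 : ℕ) + 1 : ℤ))) = 0 := by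
        simpa using circleIntegral.integral_sub_zpow_of_ne
          (n := -((n + 1 : ℕ) + 1 : ℤ)) (by push_cast; lia) 0 0 R
      rw [ih, hint (n + 1), h1, zero_smul, add_zero]
  have hlim : Tendsto (fun n : ℕ => ∮ w in C(0, R), b ^ (n + 1) * (w⁻¹ ^ (n + 1) • resolvent b w))
      atTop (𝓝 0) := by
    have hd := ((tendsto_inv_pow_mul_norm_pow_of_spectralRadius_lt h).comp
      (tendsto_add_atTop_nat 1)).const_mul (2 * Real.pi * R * M)
    rw [mul_zero] at hd
    refine squeeze_zero_norm (fun n => ?_) hd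
    refine (circleIntegral.norm_integral_le_of_norm_le_const hR.le
      (C := R⁻¹ ^ (n + 1) * ‖b ^ (n + 1)‖ * M) fun w hw => ?_).trans_eq
      (by simp only [Function.comp]; ring)
    refine (norm_mul_le _ _).trans ?_
    rw [norm_smul, norm_pow w⁻¹, norm_inv, mem_sphere_zero_iff_norm.1 hw]
    have := hM w hw
    calc ‖b ^ (n + 1)‖ * (R⁻¹ ^ (n + 1) * ‖resolvent b w‖)
        ≤ ‖b ^ (n + 1)‖ * (R⁻¹ ^ (n + 1) * M) := by gcongr
      _ = _ := by ring
  have := hlim.add_const ((2 * Real.pi * Complex.I : ℂ) • (1 : 𝔸))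
  rw [zero_add] at this
  exact tendsto_nhds_unique (tendsto_const_nhds.congr hstep) this

end HolomorphicCalculus

/-! ### Residues and Neumann series on two circles. -/

section CirclePair

variable {E : Type*} [NormedAddCommGroup E] [NormedSpace ℂ E]

/-- The integral over the two circles of radius `R` around `0` and around `z`. -/
noncomputable def circlePairIntegral (z : ℂ) (R : ℝ) (f : ℂ → E) : E :=
  (∮ w in C(0, R), f w) + ∮ w in C(z, R), f w

theorem circlePairIntegral_add {z : ℂ} {R : ℝ} (hR : 0 ≤ R) {f g : ℂ → E}
    (hf : ContinuousOn f (sphere 0 R ∪ sphere z R))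
    (hg : ContinuousOn g (sphere 0 R ∪ sphere z R)) :
    circlePairIntegral z R (fun w => f w + g w)
      = circlePairIntegral z R f + circlePairIntegral z R g := by
  have h0 := Set.subset_union_left (s := sphere (0 : ℂ) R) (t := sphere z R)
  have h1 := Set.subset_union_right (s := sphere (0 : ℂ) R) (t := sphere z R)
  unfold circlePairIntegral
  rw [circleIntegral.integral_add ((hf.mono h0).circleIntegrable hR)
      ((hg.mono h0).circleIntegrable hR),
    circleIntegral.integral_add ((hf.mono h1).circleIntegrable hR)
      ((hg.mono h1).circleIntegrable hR)]
  abel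

theorem circlePairIntegral_congr {z : ℂ} {R : ℝ} (hR : 0 ≤ R) {f g : ℂ → E}
    (h : ∀ w ∈ sphere 0 R ∪ sphere z R, f w = g w) :
    circlePairIntegral z R f = circlePairIntegral z R g := by
  unfold circlePairIntegral
  rw [circleIntegral.integral_congr hR fun w hw => h w (Or.inl hw),
    circleIntegral.integral_congr hR fun w hw => h w (Or.inr hw)]

theorem circlePairIntegral_smul_const [CompleteSpace E] (z : ℂ) (R : ℝ) (f : ℂ → ℂ) (a : E) :
    circlePairIntegral z R (fun w => f w • a) = circlePairIntegral z R f • a := by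
  simp only [circlePairIntegral, circleIntegral.integral_smul_const, add_smul]

theorem norm_circlePairIntegral_le {z : ℂ} {R C : ℝ} (hR : 0 ≤ R) {f : ℂ → E}
    (h : ∀ w ∈ sphere 0 R ∪ sphere z R, ‖f w‖ ≤ C) :
    ‖circlePairIntegral z R f‖ ≤ 2 * (2 * Real.pi * R * C) := by
  rw [two_mul]
  exact (norm_add_le _ _).trans (add_le_add
    (circleIntegral.norm_integral_le_of_norm_le_const hR fun w hw => h w (Or.inl hw))
    (circleIntegral.norm_integral_le_of_norm_le_const hR fun w hw => h w (Or.inr hw)))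

theorem ne_zero_and_ne_of_mem_sphere_union {z w : ℂ} {R : ℝ} (hR : 0 < R) (hz : R < ‖z‖)
    (hw : w ∈ sphere 0 R ∪ sphere z R) : w ≠ 0 ∧ w - z ≠ 0 := by
  simp only [Set.mem_union, mem_sphere_iff_norm, sub_zero] at hw
  constructor
  · rintro rfl
    simp only [norm_zero, zero_sub, norm_neg] at hw
    rcases hw with h | h <;> linarith
  · rw [sub_ne_zero]
    rintro rfl
    simp only [sub_self, norm_zero] at hw
    rcases hw with h | h <;> linarith

theorem circleIntegral_inv_sub_eq_zero {c w : ℂ} {R : ℝ} (hR : 0 ≤ R) (hw : R < ‖w - c‖) :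
    (∮ v in C(c, R), (v - w)⁻¹) = 0 := by
  have hne : ∀ v ∈ closedBall c R, v - w ≠ 0 := by
    intro v hv h
    rw [sub_eq_zero.1 h, mem_closedBall_iff_norm] at hv
    linarith
  refine Complex.circleIntegral_eq_zero_of_differentiable_on_off_countable hR
    Set.countable_empty ?_ fun v hv => ?_
  · exact (continuousOn_id.sub continuousOn_const).inv₀ hne
  · exact (differentiableAt_id.sub_const w).inv (hne v (ball_subset_closedBall hv.1))

theorem circlePairIntegral_zpow {z : ℂ} {R : ℝ} {n : ℤ} (hn : n ≠ -1) (v : ℂ) :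
    circlePairIntegral z R (fun w => (w - v) ^ n) = 0 := by
  simp [circlePairIntegral, circleIntegral.integral_sub_zpow_of_ne hn]

theorem continuousOn_inv_pow_mul_inv_sub_pow {z : ℂ} {R : ℝ} (hR : 0 < R) (hz : R < ‖z‖)
    (a b : ℕ) :
    ContinuousOn (fun w : ℂ => w⁻¹ ^ a * (w - z)⁻¹ ^ b) (sphere 0 R ∪ sphere z R) :=
  ((continuousOn_id.inv₀ fun _ hw => (ne_zero_and_ne_of_mem_sphere_union hR hz hw).1).pow a).mul
    (((continuousOn_id.sub continuousOn_const).inv₀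
      fun _ hw => (ne_zero_and_ne_of_mem_sphere_union hR hz hw).2).pow b)

/-- The residues of `w ^ (-a) * (w - z) ^ (-b)` add up to zero, unless `a + b = 1`. -/
theorem circlePairIntegral_inv_pow_mul_inv_sub_pow {z : ℂ} {R : ℝ} (hR : 0 < R) (hz : R < ‖z‖) :
    ∀ {N a b : ℕ}, a + b = N + 1 →
      circlePairIntegral z R (fun w => w⁻¹ ^ a * (w - z)⁻¹ ^ b)
        = if N = 0 then 2 * Real.pi * Complex.I else 0 := by
  intro N
  induction N with
  | zero =>
    intro a b hab
    obtain ⟨rfl, rfl⟩ | ⟨rfl, rfl⟩ : (a = 0 ∧ b = 1) ∨ (a = 1 ∧ b = 0) := by lia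
    · have h := circleIntegral_inv_sub_eq_zero (c := 0) (w := z) hR.le (by simpa using hz)
      simp [circlePairIntegral, circleIntegral.integral_sub_center_inv z hR.ne', h]
    · have h := circleIntegral_inv_sub_eq_zero (c := z) (w := 0) hR.le (by simpa using hz)
      have h' := circleIntegral.integral_sub_center_inv 0 hR.ne'
      simp only [sub_zero] at h h'
      simp [circlePairIntegral, h', h]
  | succ N ih =>
    intro a b hab
    rw [if_neg N.succ_ne_zero]
    rcases a with _ | a
    · have := circlePairIntegral_zpow (z := z) (R := R) (n := -(b : ℤ)) (by lia) z
      simpa using this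
    rcases b with _ | b
    · have := circlePairIntegral_zpow (z := z) (R := R) (n := -((a + 1 : ℕ) : ℤ)) (by lia) 0
      simpa only [zpow_neg, zpow_natCast, sub_zero, pow_zero, mul_one, inv_pow] using this
    have hz0 : z ≠ 0 := norm_pos_iff.1 (hR.trans hz)
    -- Partial fractions, from `z = w - (w - z)`. Both terms have the same total order, hence equal
    -- integrals by induction, and their coefficients `z⁻¹` and `-z⁻¹` cancel.
    have hpt : ∀ w ∈ sphere 0 R ∪ sphere z R, w⁻¹ ^ (a + 1) * (w - z)⁻¹ ^ (b + 1)
        = (w⁻¹ ^ a * (w - z)⁻¹ ^ (b + 1)) • z⁻¹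
          + (w⁻¹ ^ (a + 1) * (w - z)⁻¹ ^ b) • (-z⁻¹) := by
      intro w hw
      obtain ⟨h0, h1⟩ := ne_zero_and_ne_of_mem_sphere_union hR hz hw
      simp only [smul_eq_mul, pow_succ]
      field_simp
      ring
    have hc : ∀ (a b : ℕ) (v : ℂ), ContinuousOn (fun w : ℂ => (w⁻¹ ^ a * (w - z)⁻¹ ^ b) • v)
        (sphere 0 R ∪ sphere z R) := fun a b v =>
      (continuousOn_inv_pow_mul_inv_sub_pow hR hz a b).smul continuousOn_const
    rw [circlePairIntegral_congr hR.le hpt, circlePairIntegral_add hR.le (hc _ _ _) (hc _ _ _),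
      circlePairIntegral_smul_const, circlePairIntegral_smul_const, ih (by lia), ih (by lia)]
    simp

variable {𝔸 : Type*} [NormedRing 𝔸] [NormedAlgebra ℂ 𝔸]

theorem continuousOn_inv_smul_add_inv_sub_smul {z : ℂ} {R : ℝ} (hR : 0 < R) (hz : R < ‖z‖)
    (e p : 𝔸) :
    ContinuousOn (fun w : ℂ => w⁻¹ • e + (w - z)⁻¹ • p) (sphere 0 R ∪ sphere z R) := by
  have h0 := continuousOn_inv_pow_mul_inv_sub_pow hR hz 1 0
  have h1 := continuousOn_inv_pow_mul_inv_sub_pow hR hz 0 1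
  simp only [pow_one, pow_zero, mul_one, one_mul] at h0 h1
  exact (h0.smul continuousOn_const).add (h1.smul continuousOn_const)

variable [CompleteSpace 𝔸]

theorem circlePairIntegral_const_mul {z : ℂ} {R : ℝ} (hR : 0 ≤ R) (a : 𝔸) {f : ℂ → 𝔸}
    (hf : ContinuousOn f (sphere 0 R ∪ sphere z R)) :
    circlePairIntegral z R (fun w => a * f w) = a * circlePairIntegral z R f := by
  unfold circlePairIntegral
  rw [circleIntegral_const_mul a ((hf.mono Set.subset_union_left).circleIntegrable hR),
    circleIntegral_const_mul a ((hf.mono Set.subset_union_right).circleIntegrable hR), mul_add]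

/-- Multiplying out one factor of the power turns it into two noncommuting constants and raises the
order of the scalar factor by one. After `n` rounds only scalar functions of total order at least
two remain, and their residues cancel. -/
theorem circlePairIntegral_word_eq_zero {z : ℂ} {R : ℝ} (hR : 0 < R) (hz : R < ‖z‖)
    (e p x : 𝔸) (n : ℕ) : ∀ {a b : ℕ} (y : 𝔸), 2 ≤ a + b + n → 1 ≤ a + b →
      circlePairIntegral z R (fun w => (w⁻¹ ^ a * (w - z)⁻¹ ^ b) •
        (((w⁻¹ • e + (w - z)⁻¹ • p) * x) ^ n * y)) = 0 := by
  induction n with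
  | zero =>
    intro a b y h _
    obtain ⟨N, hN⟩ : ∃ N, a + b = (N + 1) + 1 := ⟨a + b - 2, by lia⟩
    simp only [pow_zero, one_mul]
    rw [circlePairIntegral_smul_const, circlePairIntegral_inv_pow_mul_inv_sub_pow hR hz hN,
      if_neg N.succ_ne_zero, zero_smul]
  | succ n ih =>
    intro a b y _ h1
    have hc : ∀ a b : ℕ, ContinuousOn (fun w : ℂ => (w⁻¹ ^ a * (w - z)⁻¹ ^ b) •
        (((w⁻¹ • e + (w - z)⁻¹ • p) * x) ^ n * y)) (sphere 0 R ∪ sphere z R) := fun a b =>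
      (continuousOn_inv_pow_mul_inv_sub_pow hR hz a b).smul
        ((((continuousOn_inv_smul_add_inv_sub_smul hR hz e p).mul continuousOn_const).pow n).mul
          continuousOn_const)
    have hpt : ∀ w ∈ sphere 0 R ∪ sphere z R, (w⁻¹ ^ a * (w - z)⁻¹ ^ b) •
          (((w⁻¹ • e + (w - z)⁻¹ • p) * x) ^ (n + 1) * y)
        = (e * x) * ((w⁻¹ ^ (a + 1) * (w - z)⁻¹ ^ b) •
            (((w⁻¹ • e + (w - z)⁻¹ • p) * x) ^ n * y))
          + (p * x) * ((w⁻¹ ^ a * (w - z)⁻¹ ^ (b + 1)) •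
            (((w⁻¹ • e + (w - z)⁻¹ • p) * x) ^ n * y)) := by
      intro w _
      rw [pow_succ' ((w⁻¹ • e + (w - z)⁻¹ • p) * x)]
      generalize ((w⁻¹ • e + (w - z)⁻¹ • p) * x) ^ n = u
      simp only [add_mul, smul_mul_assoc, mul_smul_comm, smul_add, smul_smul, mul_assoc, pow_succ]
      congr 2
      ring
    have hm : ∀ (u : 𝔸) (a b : ℕ), ContinuousOn (fun w : ℂ => u * ((w⁻¹ ^ a * (w - z)⁻¹ ^ b) •
        (((w⁻¹ • e + (w - z)⁻¹ • p) * x) ^ n * y))) (sphere 0 R ∪ sphere z R) := fun u a b =>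
      continuousOn_const.mul (hc a b)
    rw [circlePairIntegral_congr hR.le hpt, circlePairIntegral_add hR.le (hm _ _ _) (hm _ _ _),
      circlePairIntegral_const_mul hR.le _ (hc _ _), circlePairIntegral_const_mul hR.le _ (hc _ _),
      ih _ (by lia) (by lia), ih _ (by lia) (by lia), mul_zero, mul_zero, add_zero]

/-- A perturbation of `w⁻¹ • e + (w - z)⁻¹ • p`, `e + p = 1`, that is given by a convergent Neumann
series has the same integral over the two circles, namely `2πi`. -/
theorem circlePairIntegral_of_neumann {z : ℂ} {R q : ℝ} (hR : 0 < R) (hz : R < ‖z‖)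
    {e p x : 𝔸} (hep : e + p = 1) {f : ℂ → 𝔸}
    (hf : ContinuousOn f (sphere 0 R ∪ sphere z R))
    (hfe : ∀ w ∈ sphere 0 R ∪ sphere z R, f w
      = (w⁻¹ • e + (w - z)⁻¹ • p) + (w⁻¹ • e + (w - z)⁻¹ • p) * x * f w)
    (hq : q < 1) (hx : ∀ w ∈ sphere 0 R ∪ sphere z R, ‖(w⁻¹ • e + (w - z)⁻¹ • p) * x‖ ≤ q) :
    circlePairIntegral z R f = (2 * Real.pi * Complex.I : ℂ) • (1 : 𝔸) := by
  set r : ℂ → 𝔸 := fun w => w⁻¹ • e + (w - z)⁻¹ • p with hr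
  have hrc : ContinuousOn r (sphere 0 R ∪ sphere z R) :=
    continuousOn_inv_smul_add_inv_sub_smul hR hz e p
  have hpow : ∀ n : ℕ, ContinuousOn (fun w => (r w * x) ^ n) (sphere 0 R ∪ sphere z R) := fun n =>
    (hrc.mul continuousOn_const).pow n
  have hgc : ∀ (a b n : ℕ) (y : 𝔸), ContinuousOn (fun w => (w⁻¹ ^ a * (w - z)⁻¹ ^ b) •
      ((r w * x) ^ n * y)) (sphere 0 R ∪ sphere z R) := fun a b n y =>
    (continuousOn_inv_pow_mul_inv_sub_pow hR hz a b).smul ((hpow n).mul continuousOn_const)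
  have hsplit : ∀ n : ℕ, circlePairIntegral z R (fun w => (r w * x) ^ n * r w)
      = circlePairIntegral z R (fun w => (w⁻¹ ^ 1 * (w - z)⁻¹ ^ 0) • ((r w * x) ^ n * e))
        + circlePairIntegral z R (fun w => (w⁻¹ ^ 0 * (w - z)⁻¹ ^ 1) • ((r w * x) ^ n * p)) := by
    intro n
    rw [← circlePairIntegral_add hR.le (hgc _ _ _ _) (hgc _ _ _ _)]
    refine circlePairIntegral_congr hR.le fun w _ => ?_
    generalize (r w * x) ^ n = u
    simp only [hr, mul_add, mul_smul_comm, pow_one, pow_zero, mul_one, one_mul]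
  -- One step of the Neumann iteration: substitute the fixed-point equation for `f`.
  have hstep : ∀ n : ℕ, circlePairIntegral z R (fun w => (r w * x) ^ n * f w)
      = circlePairIntegral z R (fun w => (r w * x) ^ n * r w)
        + circlePairIntegral z R (fun w => (r w * x) ^ (n + 1) * f w) := by
    intro n
    refine Eq.trans (circlePairIntegral_congr hR.le fun w hw => ?_)
      (circlePairIntegral_add hR.le ((hpow n).mul hrc) ((hpow (n + 1)).mul hf))
    conv_lhs => rw [hfe w hw]
    rw [mul_add, pow_succ, mul_assoc _ (r w * x) (f w)]
  have hzero : circlePairIntegral z R (fun w => (r w * x) ^ 0 * r w)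
      = (2 * Real.pi * Complex.I : ℂ) • (1 : 𝔸) := by
    rw [hsplit]
    simp only [pow_zero (_ * x), one_mul (_ : 𝔸)]
    rw [circlePairIntegral_smul_const, circlePairIntegral_smul_const,
      circlePairIntegral_inv_pow_mul_inv_sub_pow hR hz (N := 0) (a := 1) (b := 0) rfl,
      circlePairIntegral_inv_pow_mul_inv_sub_pow hR hz (N := 0) (a := 0) (b := 1) rfl, if_pos rfl,
      ← smul_add, hep]
  have hconst : ∀ n : ℕ, circlePairIntegral z R f
      = (2 * Real.pi * Complex.I : ℂ) • (1 : 𝔸)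
        + circlePairIntegral z R (fun w => (r w * x) ^ (n + 1) * f w) := by
    intro n
    induction n with
    | zero =>
      rw [← hzero, ← hstep 0]
      simp
    | succ n ih =>
      rw [ih, hstep (n + 1), hsplit, circlePairIntegral_word_eq_zero hR hz e p x _ _ (by lia) le_rfl,
        circlePairIntegral_word_eq_zero hR hz e p x _ _ (by lia) le_rfl, zero_add, zero_add]
  obtain ⟨M, hM⟩ := ((isCompact_sphere (0 : ℂ) R).union
    (isCompact_sphere z R)).exists_bound_of_continuousOn hf
  obtain ⟨w₀, hw₀⟩ : (sphere (0 : ℂ) R).Nonempty := NormedSpace.sphere_nonempty.2 hR.le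
  have hq0 : 0 ≤ q := (norm_nonneg _).trans (hx w₀ (Or.inl hw₀))
  have hlim : Tendsto (fun n : ℕ => circlePairIntegral z R (fun w => (r w * x) ^ (n + 1) * f w))
      atTop (𝓝 0) := by
    have hd : Tendsto (fun n : ℕ => 2 * (2 * Real.pi * R * (q ^ (n + 1) * M))) atTop (𝓝 0) := by
      have := ((((tendsto_pow_atTop_nhds_zero_of_lt_one hq0 hq).comp
        (tendsto_add_atTop_nat 1)).mul_const M).const_mul (2 * Real.pi * R)).const_mul 2
      simpa using this
    refine squeeze_zero_norm (fun n => norm_circlePairIntegral_le hR.le fun w hw => ?_) hd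
    refine (norm_mul_le _ _).trans (mul_le_mul ?_ (hM w hw) (norm_nonneg _) (by positivity))
    exact (norm_pow_le' _ n.succ_pos).trans (pow_le_pow_left₀ (norm_nonneg _) (hx w hw) _)
  have := hlim.const_add ((2 * Real.pi * Complex.I : ℂ) • (1 : 𝔸))
  rw [add_zero] at this
  exact tendsto_nhds_unique (tendsto_const_nhds.congr hconst) this

end CirclePair

/-! ### Resolvents of `a + z • p` for an idempotent `p`. -/

theorem IsIdempotentElem.sub_one_sub_mul_self {𝔸 : Type*} [Ring 𝔸] {p : 𝔸}
    (hp : IsIdempotentElem p) :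
    (p - (1 - p)) * (p - (1 - p)) = 1 := by
  have h : p * p = p := hp
  have : (p - (1 - p)) * (p - (1 - p)) = 4 • (p * p) - 4 • p + 1 := by noncomm_ring
  rw [this, h, sub_self, zero_add]

/-- The element `j = p - (1 - p)` satisfies `j = j³`, so `‖j‖ ≤ ‖j‖³`; no normalisation of `‖1‖` is
needed. -/
theorem IsIdempotentElem.one_le_norm_sub_one_sub {𝔸 : Type*} [NormedRing 𝔸] {p : 𝔸}
    (hp : IsIdempotentElem p) (h : 0 < ‖p - (1 - p)‖) : 1 ≤ ‖p - (1 - p)‖ := by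
  have h1 : ‖p - (1 - p)‖ ≤ ‖p - (1 - p)‖ * ‖p - (1 - p)‖ * ‖p - (1 - p)‖ := by
    have h2 := (norm_mul_le ((p - (1 - p)) * (p - (1 - p))) (p - (1 - p))).trans
      (mul_le_mul_of_nonneg_right (norm_mul_le _ _) (norm_nonneg _))
    rwa [hp.sub_one_sub_mul_self, one_mul] at h2
  by_contra! hlt
  nlinarith [mul_lt_one_of_nonneg_of_lt_one_left h.le hlt hlt.le]

section IdempotentPerturbation

variable {𝔸 : Type*} [NormedRing 𝔸] [NormedAlgebra ℂ 𝔸]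

theorem IsIdempotentElem.norm_le_norm_sub_one_sub {p : 𝔸} (hp : IsIdempotentElem p)
    (h1 : ‖(1 : 𝔸)‖ ≤ 1) (h : 0 < ‖p - (1 - p)‖) :
    ‖p‖ ≤ ‖p - (1 - p)‖ ∧ ‖1 - p‖ ≤ ‖p - (1 - p)‖ := by
  have hj := hp.one_le_norm_sub_one_sub h
  have e1 : (2 : ℂ) • p = 1 + (p - (1 - p)) := by rw [two_smul]; abel
  have e2 : (2 : ℂ) • (1 - p) = 1 - (p - (1 - p)) := by rw [two_smul]; abel
  have n1 := congrArg norm e1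
  have n2 := congrArg norm e2
  rw [norm_smul, Complex.norm_two] at n1 n2
  have b1 := norm_add_le 1 (p - (1 - p))
  have b2 := norm_sub_le 1 (p - (1 - p))
  constructor <;> linarith

/-- The resolvent of `z • p` at `w`, for an idempotent `p`. -/
theorem IsIdempotentElem.resolvent_smul_mul {p : 𝔸} (hp : IsIdempotentElem p) {z w : ℂ}
    (h0 : w ≠ 0) (h1 : w - z ≠ 0) :
    (w⁻¹ • (1 - p) + (w - z)⁻¹ • p) * (algebraMap ℂ 𝔸 w - z • p) = 1 ∧
      (algebraMap ℂ 𝔸 w - z • p) * (w⁻¹ • (1 - p) + (w - z)⁻¹ • p) = 1 := by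
  have h : p * p = p := hp
  have e : algebraMap ℂ 𝔸 w - z • p = w • (1 - p) + (w - z) • p := by
    rw [Algebra.algebraMap_eq_smul_one, smul_sub, sub_smul]; abel
  have hq : (1 - p) * (1 - p) = 1 - p := hp.one_sub
  rw [e]
  constructor <;>
  · simp only [add_mul, mul_add, smul_mul_smul_comm, hq, h, hp.mul_one_sub_self,
      hp.one_sub_mul_self, smul_zero, add_zero, zero_add, inv_mul_cancel₀ h0, inv_mul_cancel₀ h1,
      mul_inv_cancel₀ h0, mul_inv_cancel₀ h1, one_smul, sub_add_cancel]

/-- Comparison of the resolvent of `a + z p` with that of the compression `(1 - p) a (1 - p)`. -/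
theorem IsIdempotentElem.resolvent_add_smul_sub {p : 𝔸} (hp : IsIdempotentElem p) {a : 𝔸}
    {z w : ℂ} (hw : w ∈ resolventSet ℂ (a + z • p))
    (hw' : w ∈ resolventSet ℂ ((1 - p) * a * (1 - p))) :
    resolvent (a + z • p) w - resolvent ((1 - p) * a * (1 - p)) w * (1 - p)
      = resolvent (a + z • p) w * p
        * (1 + a * (1 - p) * resolvent ((1 - p) * a * (1 - p)) w) := by
  have hq : (1 - p) * (1 - p) = 1 - p := hp.one_sub
  have hpq : p * (1 - p) = 0 := hp.mul_one_sub_self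
  have hpe : p = 1 - (1 - p) := by abel
  obtain ⟨q, hqdef⟩ : ∃ q, q = 1 - p := ⟨_, rfl⟩
  rw [← hqdef] at hq hpq hpe hw' ⊢
  have hn := smul_resolvent_eq hw'
  have hcomm : Commute (resolvent (q * a * q) w) q := by
    rw [spectrum.resolvent_eq hw']
    refine Commute.units_inv_left ?_
    refine Commute.sub_left (Algebra.commutes w q) ?_
    show q * a * q * q = q * (q * a * q)
    rw [mul_assoc (q * a), hq, mul_assoc q a q, ← mul_assoc q q, hq]
  have hres : resolvent (a + z • p) w * (algebraMap ℂ 𝔸 w - (a + z • p)) = 1 :=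
    Ring.inverse_mul_cancel _ hw
  set n := resolvent (q * a * q) w
  -- `n` commutes with `q`, so `p` kills `n * q` and the `z`-term vanishes. Splitting `a * q * n` by
  -- `1 = q + p`, the `q`-part combines with `w • n * q` to give `q`.
  have h1 : (algebraMap ℂ 𝔸 w - (a + z • p)) * (n * q) = q - p * a * q * n := by
    have e1 : w • n * q = q * a * q * n + q := by
      rw [hn, add_mul, one_mul, mul_assoc _ n q, hcomm.eq, ← mul_assoc, mul_assoc _ q q, hq]
    have e2 : p * (n * q) = 0 := by rw [hcomm.eq, ← mul_assoc, hpq, zero_mul]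
    rw [sub_mul, add_mul, smul_mul_assoc, e2, smul_zero, add_zero,
      Algebra.algebraMap_eq_smul_one, smul_mul_assoc, one_mul, ← smul_mul_assoc, e1, hcomm.eq, hpe]
    noncomm_ring
  have h2 : n * q = resolvent (a + z • p) w * (q - p * a * q * n) := by
    rw [← h1, ← mul_assoc, hres, one_mul]
  rw [h2]
  calc resolvent (a + z • p) w - resolvent (a + z • p) w * (q - p * a * q * n)
      = resolvent (a + z • p) w * ((1 - q) + p * a * q * n) := by noncomm_ring
    _ = _ := by rw [← hpe]; noncomm_ring

theorem norm_resolvent_le {b : 𝔸} {w : ℂ} (h1 : ‖(1 : 𝔸)‖ ≤ 1) (hb : ‖b‖ < ‖w‖)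
    (hw : w ∈ resolventSet ℂ b) : ‖resolvent b w‖ ≤ 1 / (‖w‖ - ‖b‖) := by
  have h := congrArg norm (smul_resolvent_eq hw)
  rw [norm_smul] at h
  have h2 := (norm_add_le (b * resolvent b w) 1).trans
    (add_le_add (norm_mul_le b (resolvent b w)) h1)
  rw [le_div_iff₀ (by linarith)]
  linarith

theorem le_norm_of_mem_sphere_union {z w : ℂ} {R : ℝ} (hz : 2 * R ≤ ‖z‖)
    (hw : w ∈ sphere 0 R ∪ sphere z R) : R ≤ ‖w‖ ∧ R ≤ ‖w - z‖ := by
  simp only [Set.mem_union, mem_sphere_iff_norm, sub_zero] at hw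
  have h1 := norm_sub_norm_le z w
  have h2 := norm_sub_rev z w
  rcases hw with h | h <;> constructor <;> linarith

/-- A bound for the resolvent of `z p` on two well separated circles of radius
`2 (‖a‖ + δ) ‖p - (1 - p)‖` around `0` and `z`. -/
theorem IsIdempotentElem.norm_resolvent_smul_le {p : 𝔸} (hp : IsIdempotentElem p) {a : 𝔸}
    {z w : ℂ} {R δ : ℝ} (h1 : ‖(1 : 𝔸)‖ ≤ 1) (hδ : 0 < δ) (hR : 0 < R)
    (hRd : R = 2 * (‖a‖ + δ) * ‖p - (1 - p)‖) (hz : 2 * R ≤ ‖z‖)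
    (hw : w ∈ sphere 0 R ∪ sphere z R) :
    ‖w⁻¹ • (1 - p) + (w - z)⁻¹ • p‖ ≤ 1 / (‖a‖ + δ) := by
  have ha : 0 < ‖a‖ + δ := by positivity
  have hJ : 0 < ‖p - (1 - p)‖ := by
    by_contra! h
    have : ‖p - (1 - p)‖ = 0 := le_antisymm h (norm_nonneg _)
    rw [this, mul_zero] at hRd
    exact hR.ne' hRd
  obtain ⟨hp1, hq1⟩ := hp.norm_le_norm_sub_one_sub h1 hJ
  obtain ⟨hw0, hwz⟩ := le_norm_of_mem_sphere_union hz hw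
  calc ‖w⁻¹ • (1 - p) + (w - z)⁻¹ • p‖
      ≤ ‖w‖⁻¹ * ‖1 - p‖ + ‖w - z‖⁻¹ * ‖p‖ := by
        refine (norm_add_le _ _).trans_eq ?_
        rw [norm_smul, norm_smul, norm_inv, norm_inv]
    _ ≤ R⁻¹ * ‖p - (1 - p)‖ + R⁻¹ * ‖p - (1 - p)‖ := by gcongr
    _ = 1 / (‖a‖ + δ) := by rw [hRd]; field_simp; norm_num

variable [CompleteSpace 𝔸]

/-- With `r` the resolvent of `z • p`, one has `w - (a + z • p) = (w - z • p) * (1 - r * a)`, and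
the second factor is invertible by the Neumann series. -/
theorem IsIdempotentElem.resolvent_add_smul {p : 𝔸} (hp : IsIdempotentElem p) {a : 𝔸} {z w : ℂ}
    (h0 : w ≠ 0) (h1 : w - z ≠ 0) (ha : ‖(w⁻¹ • (1 - p) + (w - z)⁻¹ • p) * a‖ < 1) :
    w ∈ resolventSet ℂ (a + z • p) ∧
      resolvent (a + z • p) w = (w⁻¹ • (1 - p) + (w - z)⁻¹ • p)
        + (w⁻¹ • (1 - p) + (w - z)⁻¹ • p) * a * resolvent (a + z • p) w := by
  obtain ⟨hl, hr⟩ := hp.resolvent_smul_mul h0 h1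
  set r := w⁻¹ • (1 - p) + (w - z)⁻¹ • p
  set d := algebraMap ℂ 𝔸 w - z • p with hd
  have e : algebraMap ℂ 𝔸 w - (a + z • p) = d * (1 - r * a) := by
    rw [mul_sub, mul_one, ← mul_assoc, hr, one_mul, hd]; abel
  have hu : IsUnit (algebraMap ℂ 𝔸 w - (a + z • p)) := by
    rw [e]
    exact (Units.mk d r hr hl).isUnit.mul (isUnit_one_sub_of_norm_lt_one ha)
  refine ⟨hu, ?_⟩
  have hres : (algebraMap ℂ 𝔸 w - (a + z • p)) * resolvent (a + z • p) w = 1 :=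
    Ring.mul_inverse_cancel _ hu
  have h2 : (1 - r * a) * resolvent (a + z • p) w = r := by
    calc (1 - r * a) * resolvent (a + z • p) w
        = r * d * ((1 - r * a) * resolvent (a + z • p) w) := by rw [hl, one_mul]
      _ = r * (d * (1 - r * a) * resolvent (a + z • p) w) := by simp only [mul_assoc]
      _ = r := by rw [← e, hres, mul_one]
  rw [sub_mul, one_mul, sub_eq_iff_eq_add] at h2
  exact h2

/-- The explicit estimate, with any upper bound `S` on the circle about `0` in place of the
supremum, so that it serves both assertions of the theorem. -/
theorem IsIdempotentElem.norm_exp_add_smul_sub_le {p : 𝔸} (hp : IsIdempotentElem p) {a : 𝔸}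
    (h1 : ‖(1 : 𝔸)‖ ≤ 1) {R δ S T₁ T₂ t : ℝ} {z : ℂ} (hδ : 0 < δ)
    (hRd : R = 2 * (‖a‖ + δ) * ‖p - (1 - p)‖)
    (hspec : spectralRadius ℂ ((1 - p) * a * (1 - p)) < ENNReal.ofReal R)
    (hS : ∀ w ∈ sphere (0 : ℂ) R,
      ‖1 + a * (1 - p) * resolvent ((1 - p) * a * (1 - p)) w‖ ≤ S)
    (hz : z.re < -2 * R) (hT₁ : 0 < T₁) (ht : t ∈ Set.Icc T₁ T₂) :
    ‖NormedSpace.exp ((t : ℂ) • (a + z • p))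
        - NormedSpace.exp ((t : ℂ) • ((1 - p) * a * (1 - p))) * (1 - p)‖
      ≤ R * Real.exp (T₁ * R) / δ * Real.exp (T₁ * z.re)
        + R * Real.exp (T₂ * R) * ((‖a‖ + δ) / δ) * ‖p‖ * S * (1 / (‖z‖ - R)) := by
  have hR : 0 < R := ENNReal.ofReal_pos.1 (bot_le.trans_lt hspec)
  have ht0 : 0 < t := hT₁.trans_le ht.1
  have had : 0 < ‖a‖ + δ := by positivity
  have hz2 : 2 * R ≤ ‖z‖ := by
    have := (neg_le_abs z.re).trans (Complex.abs_re_le_norm z)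
    linarith
  have hzR : R < ‖z‖ := by linarith
  have hr := fun w hw => hp.norm_resolvent_smul_le (w := w) h1 hδ hR hRd hz2 hw
  have hra : ∀ w ∈ sphere 0 R ∪ sphere z R,
      ‖(w⁻¹ • (1 - p) + (w - z)⁻¹ • p) * a‖ ≤ ‖a‖ / (‖a‖ + δ) := by
    intro w hw
    refine (norm_mul_le _ _).trans ?_
    rw [div_eq_mul_one_div, mul_comm]
    exact mul_le_mul_of_nonneg_left (hr w hw) (norm_nonneg _)
  have hq : ‖a‖ / (‖a‖ + δ) < 1 := by rw [div_lt_one had]; linarith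
  have hB : ∀ w ∈ sphere 0 R ∪ sphere z R, _ := fun w hw =>
    hp.resolvent_add_smul (a := a) (ne_zero_and_ne_of_mem_sphere_union hR hzR hw).1
      (ne_zero_and_ne_of_mem_sphere_union hR hzR hw).2 ((hra w hw).trans_lt hq)
  -- The right factor `y` is kept because `y = p` gives the decay in `z` on the circle about `0`,
  -- while `y = 1` suffices on the circle about `z`.
  have hBmul : ∀ w ∈ sphere 0 R ∪ sphere z R, ∀ y : 𝔸, ‖resolvent (a + z • p) w * y‖
      ≤ (‖a‖ + δ) / δ * ‖(w⁻¹ • (1 - p) + (w - z)⁻¹ • p) * y‖ := by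
    intro w hw y
    have e := congrArg (fun v => ‖v * y‖) (hB w hw).2
    rw [add_mul _ _ y, mul_assoc _ (resolvent _ _) y] at e
    have h2 := (norm_add_le ((w⁻¹ • (1 - p) + (w - z)⁻¹ • p) * y)
      ((w⁻¹ • (1 - p) + (w - z)⁻¹ • p) * a * (resolvent (a + z • p) w * y))).trans
      (add_le_add_right ((norm_mul_le _ _).trans
        (mul_le_mul_of_nonneg_right (hra w hw) (norm_nonneg _))) _)
    rw [← e] at h2
    have h3 : 1 - ‖a‖ / (‖a‖ + δ) = δ / (‖a‖ + δ) := by field_simp; ring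
    have h4 : δ / (‖a‖ + δ) * ‖resolvent (a + z • p) w * y‖
        ≤ ‖(w⁻¹ • (1 - p) + (w - z)⁻¹ • p) * y‖ := by
      rw [← h3]; linarith
    calc ‖resolvent (a + z • p) w * y‖
        = (‖a‖ + δ) / δ * (δ / (‖a‖ + δ) * ‖resolvent (a + z • p) w * y‖) := by field_simp
      _ ≤ _ := by gcongr
  have hBc : ContinuousOn (resolvent (a + z • p)) (sphere 0 R ∪ sphere z R) :=
    continuousOn_resolvent fun w hw => (hB w hw).1
  have hB0 : ContinuousOn (resolvent (a + z • p)) (sphere (0 : ℂ) R) :=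
    hBc.mono Set.subset_union_left
  have hBz : ContinuousOn (resolvent (a + z • p)) (sphere z R) := hBc.mono Set.subset_union_right
  have hM := sphere_subset_resolventSet_of_spectralRadius_lt hspec
  have hMc := continuousOn_resolvent hM
  have hexpc : ∀ {s : Set ℂ} {f : ℂ → 𝔸}, ContinuousOn f s →
      ContinuousOn (fun w => Complex.exp (t * w) • f w) s := fun hf =>
    ContinuousOn.smul (by fun_prop) hf
  have hπ : (2 * Real.pi * Complex.I : ℂ) ≠ 0 := Complex.two_pi_I_ne_zero
  have hexpB : NormedSpace.exp ((t : ℂ) • (a + z • p)) = (2 * Real.pi * Complex.I : ℂ)⁻¹ •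
      ((∮ w in C(0, R), Complex.exp (t * w) • resolvent (a + z • p) w)
        + ∮ w in C(z, R), Complex.exp (t * w) • resolvent (a + z • p) w) := by
    rw [circleIntegral_exp_smul_of_smul_eq hR.le hB0
        (fun w hw => smul_resolvent_eq (hB w (Or.inl hw)).1),
      circleIntegral_exp_smul_of_smul_eq hR.le hBz
        (fun w hw => smul_resolvent_eq (hB w (Or.inr hw)).1), ← mul_add]
    have h := circlePairIntegral_of_neumann hR hzR (sub_add_cancel 1 p) hBc
      (fun w hw => (hB w hw).2) hq hra
    unfold circlePairIntegral at h
    rw [h, mul_smul_comm, mul_one, inv_smul_smul₀ hπ]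
  have hexpM : NormedSpace.exp ((t : ℂ) • ((1 - p) * a * (1 - p))) * (1 - p)
      = (2 * Real.pi * Complex.I : ℂ)⁻¹ • ∮ w in C(0, R),
        Complex.exp (t * w) • (resolvent ((1 - p) * a * (1 - p)) w * (1 - p)) := by
    have h := circleIntegral_exp_smul_of_smul_eq hR.le hMc
      (fun w hw => smul_resolvent_eq (hM hw)) (t : ℂ)
    rw [circleIntegral_resolvent_of_spectralRadius_lt hspec, mul_smul_comm, mul_one] at h
    rw [circleIntegral.integral_congr hR.le
      fun w _ => (smul_mul_assoc (Complex.exp (t * w)) _ _).symm,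
      circleIntegral_mul_const _ ((hexpc hMc).circleIntegrable hR.le), h,
      smul_mul_assoc, inv_smul_smul₀ hπ]
  have hsplit : NormedSpace.exp ((t : ℂ) • (a + z • p))
        - NormedSpace.exp ((t : ℂ) • ((1 - p) * a * (1 - p))) * (1 - p)
      = ((2 * Real.pi * Complex.I : ℂ)⁻¹ • ∮ w in C(z, R),
          Complex.exp (t * w) • resolvent (a + z • p) w)
        + (2 * Real.pi * Complex.I : ℂ)⁻¹ • ∮ w in C(0, R), Complex.exp (t * w) •
          (resolvent (a + z • p) w * p
            * (1 + a * (1 - p) * resolvent ((1 - p) * a * (1 - p)) w)) := by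
    have hdiff : (∮ w in C(0, R), Complex.exp (t * w) • (resolvent (a + z • p) w * p
          * (1 + a * (1 - p) * resolvent ((1 - p) * a * (1 - p)) w)))
        = (∮ w in C(0, R), Complex.exp (t * w) • resolvent (a + z • p) w)
          - ∮ w in C(0, R),
            Complex.exp (t * w) • (resolvent ((1 - p) * a * (1 - p)) w * (1 - p)) := by
      have hNc : ContinuousOn (fun w => resolvent ((1 - p) * a * (1 - p)) w * (1 - p))
        (sphere (0 : ℂ) R) := hMc.mul continuousOn_const
      rw [← circleIntegral.integral_sub ((hexpc hB0).circleIntegrable hR.le)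
        ((hexpc hNc).circleIntegrable hR.le)]
      refine circleIntegral.integral_congr hR.le fun w hw => ?_
      simp only [← smul_sub]
      rw [hp.resolvent_add_smul_sub (hB w (Or.inl hw)).1 (hM hw)]
    rw [hexpB, hexpM, hdiff, smul_add, smul_sub]
    abel
  have hnexp : ∀ w : ℂ, ‖Complex.exp (t * w)‖ = Real.exp (t * w.re) := fun w => by
    rw [Complex.norm_exp, Complex.re_ofReal_mul]
  rw [hsplit]
  refine (norm_add_le _ _).trans (add_le_add ?_ ?_)
  · refine (circleIntegral.norm_two_pi_i_inv_smul_integral_le_of_norm_le_const hR.le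
      (C := Real.exp (T₁ * (R + z.re)) * (1 / δ)) fun w hw => ?_).trans_eq ?_
    · rw [norm_smul, hnexp]
      have hre : w.re ≤ R + z.re := by
        have := (Complex.re_le_norm (w - z)).trans_eq (mem_sphere_iff_norm.1 hw)
        rw [Complex.sub_re] at this
        linarith
      have hnorm : ‖resolvent (a + z • p) w‖ ≤ 1 / δ := by
        have h2 := hBmul w (Or.inr hw) 1
        rw [mul_one, mul_one] at h2
        calc _ ≤ _ := h2
          _ ≤ (‖a‖ + δ) / δ * (1 / (‖a‖ + δ)) := by gcongr; exact hr w (Or.inr hw)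
          _ = 1 / δ := by field_simp
      -- Here `R + z.re` is negative, so the smallest time `T₁` is the worst case.
      have hexp : t * w.re ≤ T₁ * (R + z.re) := by
        nlinarith [mul_le_mul_of_nonneg_left hre ht0.le, ht.1]
      gcongr
    · rw [mul_add, Real.exp_add]
      ring
  · refine (circleIntegral.norm_two_pi_i_inv_smul_integral_le_of_norm_le_const hR.le
      (C := Real.exp (T₂ * R) * ((‖a‖ + δ) / δ * (‖p‖ * (1 / (‖z‖ - R))) * S))
      fun w hw => ?_).trans_eq (by ring)
    rw [norm_smul, hnexp]
    obtain ⟨hw0, hwz⟩ := ne_zero_and_ne_of_mem_sphere_union hR hzR (Or.inl hw)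
    have hwn := mem_sphere_zero_iff_norm.1 hw
    have hexp : t * w.re ≤ T₂ * R := by
      have hre := (Complex.re_le_norm w).trans_eq hwn
      exact (mul_le_mul_of_nonneg_left hre ht0.le).trans (mul_le_mul_of_nonneg_right ht.2 hR.le)
    -- The part `w⁻¹ • (1 - p)`, which does not decay in `z`, is annihilated by `p`.
    have hrp : (w⁻¹ • (1 - p) + (w - z)⁻¹ • p) * p = (w - z)⁻¹ • p := by
      rw [add_mul, smul_mul_assoc, smul_mul_assoc, hp.one_sub_mul_self, smul_zero, zero_add, hp.eq]
    have hnorm : ‖resolvent (a + z • p) w * p‖ ≤ (‖a‖ + δ) / δ * (‖p‖ * (1 / (‖z‖ - R))) := by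
      have h2 := hBmul w (Or.inl hw) p
      rw [hrp, norm_smul, norm_inv, mul_comm _ ‖p‖, ← one_div] at h2
      refine h2.trans ?_
      have h3 : ‖z‖ - R ≤ ‖w - z‖ := by
        rw [← hwn, norm_sub_rev]
        exact norm_sub_norm_le z w
      have h4 : 0 < ‖z‖ - R := by linarith
      gcongr
    refine mul_le_mul (Real.exp_le_exp.2 hexp) ((norm_mul_le _ _).trans
      (mul_le_mul hnorm (hS w hw) (norm_nonneg _) ((norm_nonneg _).trans hnorm)))
      (norm_nonneg _) (Real.exp_nonneg _)

end IdempotentPerturbation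

/-- On the negative half-line, `exp (T x)` decays at least like `1 / |x|`. -/
theorem Real.exp_mul_le_inv_div_abs {T x : ℝ} (hT : 0 < T) (hx : x < 0) :
    Real.exp (T * x) ≤ T⁻¹ / |x| := by
  have h1 : 0 < T * |x| := mul_pos hT (abs_pos.2 hx.ne)
  have h2 := Real.add_one_le_exp (T * |x|)
  have h3 : T * x = -(T * |x|) := by rw [abs_of_neg hx]; ring
  rw [h3, Real.exp_neg, div_eq_mul_inv, ← mul_inv]
  exact inv_anti₀ h1 (by linarith)

/-! ### The estimates for operators on a Banach space. -/

theorem mainTheorem2 {X : Type*} [NormedAddCommGroup X] [NormedSpace ℂ X] [CompleteSpace X]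
    (A P Q : X →L[ℂ] X) (hP : IsIdempotentElem P) (hQ : Q = 1 - P) :
    -- at least linear rate as `Re z → -∞`, uniformly for `t` in a compact subset of `(0, ∞)`
    (∀ K : Set ℝ, K ⊆ Set.Ioi 0 → IsCompact K →
      ∃ C s : ℝ, 0 < s ∧ ∀ z : ℂ, z.re < -s → ∀ t ∈ K,
        ‖NormedSpace.exp ((t : ℂ) • (A + z • P))
            - NormedSpace.exp ((t : ℂ) • (Q * A * Q)) * Q‖ ≤ C / |z.re|) ∧
    -- the explicit estimate
    ∀ T₁ T₂ δ R S C₁ C₂ : ℝ, 0 < T₁ → T₁ < T₂ → 0 < δ →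
      R = 2 * (‖A‖ + δ) * ‖P - Q‖ →
      spectralRadius ℂ (Q * A * Q) < ENNReal.ofReal R →
      S = sSup ((fun μ : ℂ => ‖1 + A * Q * resolvent (Q * A * Q) μ‖) '' Metric.sphere 0 R) →
      C₁ = R * Real.exp (T₁ * R) / δ →
      C₂ = R * Real.exp (T₂ * R) * ((‖A‖ + δ) / δ) * ‖P‖ * S →
      -- the supremum is taken over resolvents that exist, and it is finite
      Metric.sphere (0 : ℂ) R ⊆ resolventSet ℂ (Q * A * Q) ∧
      BddAbove ((fun μ : ℂ => ‖1 + A * Q * resolvent (Q * A * Q) μ‖) '' Metric.sphere 0 R) ∧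
      (∀ z : ℂ, z.re < -2 * R → ∀ t ∈ Set.Icc T₁ T₂,
        ‖NormedSpace.exp ((t : ℂ) • (A + z • P))
            - NormedSpace.exp ((t : ℂ) • (Q * A * Q)) * Q‖
          ≤ C₁ * Real.exp (T₁ * z.re) + C₂ * (1 / (‖z‖ - R))) ∧
      -- the further bound on `C₂` given by the Neumann series
      (‖Q * A * Q‖ < R →
        C₂ ≤ R * Real.exp (T₂ * R) * ((‖A‖ + δ) / δ) * ‖P‖
          * (1 + ‖A * Q‖ / (R - ‖Q * A * Q‖))) := by
  subst hQ
  have h1 : ‖(1 : X →L[ℂ] X)‖ ≤ 1 := ContinuousLinearMap.norm_id_le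
  have hcont : ∀ R : ℝ, spectralRadius ℂ ((1 - P) * A * (1 - P)) < ENNReal.ofReal R →
      ContinuousOn (fun μ : ℂ => ‖1 + A * (1 - P) * resolvent ((1 - P) * A * (1 - P)) μ‖)
        (Metric.sphere 0 R) := fun R hR =>
    (continuousOn_const.add (continuousOn_const.mul (continuousOn_resolvent
      (sphere_subset_resolventSet_of_spectralRadius_lt hR)))).norm
  constructor
  · intro K hK hKc
    rcases K.eq_empty_or_nonempty with rfl | hne
    · exact ⟨0, 1, one_pos, by simp⟩
    -- On the zero space `P - Q = 0`, which would force `R = 0`; the claim is trivial there.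
    rcases subsingleton_or_nontrivial X with hX | hX
    · refine ⟨0, 1, one_pos, fun z _ t _ => ?_⟩
      rw [Subsingleton.elim (_ - _ : X →L[ℂ] X) 0, norm_zero, zero_div]
    obtain ⟨T₁, hT₁⟩ := hKc.exists_isLeast hne
    obtain ⟨T₂, hT₂⟩ := hKc.exists_isGreatest hne
    have hT₁0 : 0 < T₁ := hK hT₁.1
    -- Since `‖P - Q‖ ≥ 1`, this choice makes `R` exceed `‖QAQ‖`, and so the spectral radius.
    set δ := ‖(1 - P) * A * (1 - P)‖ + 1 with hδ
    have hδ0 : 0 < δ := by positivity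
    have hJ : 0 < ‖P - (1 - P)‖ := norm_pos_iff.2 fun h => by
      have := hP.sub_one_sub_mul_self
      rw [h, mul_zero] at this
      exact zero_ne_one this
    obtain ⟨R, hR⟩ : ∃ R, R = 2 * (‖A‖ + δ) * ‖P - (1 - P)‖ := ⟨_, rfl⟩
    have hRlt : ‖(1 - P) * A * (1 - P)‖ < R := by
      have h2 : 2 * (‖A‖ + δ) * 1 ≤ R := by
        rw [hR]
        exact mul_le_mul_of_nonneg_left (hP.one_le_norm_sub_one_sub hJ) (by positivity)
      linarith [norm_nonneg A, norm_nonneg ((1 - P) * A * (1 - P))]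
    have hR0 : 0 < R := (norm_nonneg _).trans_lt hRlt
    have hspec : spectralRadius ℂ ((1 - P) * A * (1 - P)) < ENNReal.ofReal R := by
      refine (spectrum.spectralRadius_le_nnnorm _).trans_lt ?_
      rw [← enorm_eq_nnnorm, ← ofReal_norm]
      exact (ENNReal.ofReal_lt_ofReal_iff hR0).2 hRlt
    obtain ⟨S, hS⟩ := (isCompact_sphere (0 : ℂ) R).exists_bound_of_continuousOn (hcont R hspec)
    simp only [norm_norm] at hS
    set C₁ := R * Real.exp (T₁ * R) / δ with hC₁
    set C₂ := R * Real.exp (T₂ * R) * ((‖A‖ + δ) / δ) * ‖P‖ * |S| with hC₂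
    have hC₁0 : 0 ≤ C₁ := by positivity
    have hC₂0 : 0 ≤ C₂ := by positivity
    -- `T₁⁻¹` comes from `exp(T₁ x) ≤ T₁⁻¹ / |x|` for `x < 0`. The factor `2` comes from `‖z‖ - R ≥
    -- |z.re| / 2`, valid once `|z.re| > 2 * R`.
    refine ⟨C₁ * T₁⁻¹ + C₂ * 2, 2 * R, by positivity, fun z hz t ht => ?_⟩
    have hre : z.re < 0 := by linarith
    have hmain := hP.norm_exp_add_smul_sub_le h1 hδ0 hR hspec
      (fun w hw => (hS w hw).trans (le_abs_self S)) (by linarith) hT₁0 ⟨hT₁.2 ht, hT₂.2 ht⟩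
    rw [← hC₁, ← hC₂] at hmain
    refine hmain.trans ?_
    have hz1 : 2 * R < |z.re| := by rw [abs_of_neg hre]; linarith
    have hz2 := Complex.abs_re_le_norm z
    have hinv : 1 / (‖z‖ - R) ≤ 2 / |z.re| := by
      rw [div_le_div_iff₀ (by linarith) (by linarith)]
      linarith
    rw [add_div, mul_div_assoc C₁, mul_div_assoc C₂]
    exact add_le_add (mul_le_mul_of_nonneg_left (Real.exp_mul_le_inv_div_abs hT₁0 hre) hC₁0)
      (mul_le_mul_of_nonneg_left hinv hC₂0)
  · intro T₁ T₂ δ R S C₁ C₂ hT₁ _ hδ hR hspec hS hC₁ hC₂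
    have hR0 : 0 < R := ENNReal.ofReal_pos.1 (bot_le.trans_lt hspec)
    have hres := sphere_subset_resolventSet_of_spectralRadius_lt hspec
    have hbdd := (isCompact_sphere (0 : ℂ) R).bddAbove_image (hcont R hspec)
    refine ⟨hres, hbdd, fun z hz t ht => ?_, fun hlt => ?_⟩
    · rw [hC₁, hC₂]
      refine hP.norm_exp_add_smul_sub_le h1 hδ hR hspec (fun w hw => ?_) hz hT₁ ht
      rw [hS]
      exact le_csSup hbdd (Set.mem_image_of_mem _ hw)
    · rw [hC₂]
      refine mul_le_mul_of_nonneg_left ?_ (by positivity)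
      rw [hS]
      refine csSup_le ((NormedSpace.sphere_nonempty.2 hR0.le).image _) ?_
      rintro _ ⟨w, hw, rfl⟩
      have hwn := mem_sphere_zero_iff_norm.1 hw
      have hn := norm_resolvent_le h1 (hlt.trans_eq hwn.symm) (hres hw)
      rw [hwn] at hn
      refine (norm_add_le _ _).trans (add_le_add h1 ((norm_mul_le _ _).trans ?_))
      rw [div_eq_mul_one_div]
      exact mul_le_mul_of_nonneg_left hn (norm_nonneg _)
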